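/- Let $d\in\mathbb N$, $T>0$ and $0<s<1$. For real-valued $a,b,c\in L^\infty(\mathbb R^d)$ and $v,\varphi\in H^1(\mathbb R^d)$ (complex-valued) put $$B_{a,b,c}(v,\varphi)=\int_{\mathbb R^d} a\,\nabla v\cdot\overline{\nabla\varphi}\,dx+\int_{\mathbb R^d} b\,(-\Delta)^{s/2}v\,\overline{(-\Delta)^{s/2}\varphi}\,dx+\int_{\mathbb R^d} c\,v\,\overline{\varphi}\,dx ,$$ where $(-\Delta)^{s/2}$ is the Fourier multiplier with symbol $|\xi|^{s}$ (for the Fourier transform $\hat v(\xi)=\int e^{-ix\cdot\xi}v(x)\,dx$). For $u_0\in H^1(\mathbb R^d)$, a weak solution of the Cauchy problem $$u_t-\nabla\cdot(a\nabla u)+(-\Delta)^{s/2}\bigl(b\,(-\Delta)^{s/2}u\bigr)+c\,u=0\ \text{ in }(0,T)\times\mathbb R^d,\qquad u(0)=u_0,$$ is a function $u\in L^2(0,T;H^1(\mathbb R^d))$ with distributional time derivative $u_t\in L^2(0,T;(H^1(\mathbb R^d))')$ (in the Gelfand triple $H^1\subset L^2\subset (H^1)'$, where $(H^1)'$ consists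 of the continuous conjugate-linear functionals; note $H^1\cap H^s=H^1$), such that $\langle u_t(t),\varphi\rangle+B_{a,b,c}(u(t),\varphi)=0$ for a.e. $t\in(0,T)$ and all $\varphi\in H^1(\mathbb R^d)$, and such that the representative of $u$ in $C([0,T];L^2(\mathbb R^d))$ takes the value $u_0$ at $t=0$. **Theorem (Consistency).** Let $a,b,c\in L^\infty(\mathbb R^d)$ be real-valued, and let $a_0,b_0,c_0>0$ be constants such that $$a(x)\ge a_0,\qquad b(x)\ge b_0,\qquad c(x)\ge c_0\qquad\text{for a.e. }x\in\mathbb R^d .$$ Let $u_0\in H^1(\mathbb R^d)$ and let $u$ be the weak solution of the Cauchy problem with data $a,b,c,u_0$. For $\varepsilon\in(0,1]$ let $a_\varepsilon,b_\varepsilon,c_\varepsilon\in L^\infty(\mathbb R^d)$ be real-valued and $u_{0,\varepsilon}\in H^1(\mathbb R^d)$, such that, as $\varepsilon\to0^+$, $$a_\varepsilon\to a,\quad b_\varepsilon\to b,\quad c_\varepsilon\to c\ \text{ in }L^\infty(\mathbb R^d),\qquad u_{0,\varepsilon}\to u_0\ \text{ in }H^1(\mathbb R^d),$$ and such that, for every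 $\varepsilon\in(0,1]$, $$a_\varepsilon(x)\ge a_0,\qquad b_\varepsilon(x)\ge b_0,\qquad c_\varepsilon(x)\ge c_0\qquad\text{for a.e. }x\in\mathbb R^d .$$ For each $\varepsilon\in(0,1]$ let $u_\varepsilon$ be the weak solution of the Cauchy problem with data $a_\varepsilon,b_\varepsilon,c_\varepsilon,u_{0,\varepsilon}$. Then $$u_\varepsilon\to u\quad\text{in } C([0,T];L^2(\mathbb R^d))\ \text{ and in }\ L^2(0,T;H^1(\mathbb R^d))\quad\text{as }\varepsilon\to0^+ .$$ -/

import Mathlib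

open MeasureTheory Set Filter Topology
open scoped ENNReal FourierTransform LineDeriv SchwartzMap ContDiff ComplexConjugate

noncomputable section

namespace MixedHeat

/-- `ℝ^d` with its Euclidean norm and Lebesgue measure. -/
abbrev Space (d : ℕ) : Type := EuclideanSpace ℝ (Fin d)

/-- The complex Lebesgue space `L²(ℝ^d)`. -/
abbrev L2 (d : ℕ) : Type := Lp ℂ 2 (volume : Measure (Space d))

/-- The real Lebesgue space `L^∞(ℝ^d)`, in which the coefficients live. -/
abbrev Linf (d : ℕ) : Type := Lp ℝ ∞ (volume : Measure (Space d))

/-- The Sobolev space `H¹(ℝ^d)`: the pairs `(u, (g₁, …, g_d))` of `L²` functions such that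
`gᵢ` is the distributional derivative `∂ᵢ u`. The first component determines the pair. The norm is
the one of the ambient Hilbert space, `‖u‖² = ‖u‖²_{L²} + ∑ᵢ ‖∂ᵢ u‖²_{L²}`. -/
def H1Submodule (d : ℕ) : Submodule ℂ (WithLp 2 (L2 d × PiLp 2 fun _ : Fin d => L2 d)) where
  carrier := {p | ∀ i : Fin d,
    ∂_{EuclideanSpace.single i (1 : ℝ)} (Lp.toTemperedDistribution p.fst : 𝓢'(Space d, ℂ))
      = Lp.toTemperedDistribution (p.snd i)}
  add_mem' := by
    intro p q hp hq i
    have h1 := hp i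
    have h2 := hq i
    simp only [← Lp.toTemperedDistributionCLM_apply] at h1 h2 ⊢
    simp only [WithLp.add_fst, WithLp.add_snd, PiLp.add_apply, map_add,
      LineDeriv.lineDerivOp_add, h1, h2]
  zero_mem' := by
    intro i
    simp only [← Lp.toTemperedDistributionCLM_apply]
    simp only [WithLp.zero_fst, WithLp.zero_snd, PiLp.zero_apply, map_zero,
      LineDeriv.lineDerivOp_zero]
  smul_mem' := by
    intro c p hp i
    have h1 := hp i
    simp only [← Lp.toTemperedDistributionCLM_apply] at h1 ⊢
    simp only [WithLp.smul_fst, WithLp.smul_snd, PiLp.smul_apply, map_smul,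
      LineDeriv.lineDerivOp_smul, h1]

/-- `H¹(ℝ^d)` as a type. -/
abbrev H1 (d : ℕ) : Type := H1Submodule d

variable {d : ℕ}

/-- The embedding `H¹(ℝ^d) → L²(ℝ^d)`. -/
def H1.toL2 (u : H1 d) : L2 d := (u : WithLp 2 (L2 d × PiLp 2 fun _ : Fin d => L2 d)).fst

/-- The `i`-th weak partial derivative of an `H¹` function. -/
def H1.partialDeriv (u : H1 d) (i : Fin d) : L2 d :=
  (u : WithLp 2 (L2 d × PiLp 2 fun _ : Fin d => L2 d)).snd i

/-- The antidual of `H¹(ℝ^d)`: continuous conjugate-linear functionals. Since `0 < s < 1`, the space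
`H¹ ∩ H^s` is `H¹`, with an equivalent norm. -/
abbrev H1Dual (d : ℕ) : Type := H1 d →L⋆[ℂ] ℂ

/-- The function `|ξ|^{2σ} û(ξ)` on the frequency side. With the normalisation
`û(ξ) = ∫ e^{-2πi⟨x, ξ⟩} u(x) dx` of `𝓕`, the frequency `ξ` of the convention
`∫ e^{-i⟨x, ξ⟩} u(x) dx` is `2πξ`. -/
def fracSymbolMul (σ : ℝ) (u : L2 d) (ξ : Space d) : ℂ :=
  (((2 * Real.pi * ‖ξ‖) ^ (2 * σ) : ℝ) : ℂ) * (𝓕 u : L2 d) ξ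

open Classical in
/-- The Riesz fractional Laplacian `(-Δ)^σ u` in `L²(ℝ^d)`, that is, the `L²` function with Fourier
transform `|ξ|^{2σ} û(ξ)`. It is set to `0` for those `u ∈ L²` for which this is not in `L²`. -/
def fracLaplacian (σ : ℝ) (u : L2 d) : L2 d :=
  if h : MemLp (fracSymbolMul σ u) 2 volume then 𝓕⁻ (h.toLp (fracSymbolMul σ u)) else 0

/-- On the frequency side, the weak partial derivative `∂ᵢ` is multiplication by `2πi ξᵢ`. -/
theorem fourier_partialDeriv_ae (u : H1 d) (i : Fin d) :
    ∀ᵐ ξ, (𝓕 (u.partialDeriv i) : L2 d) ξ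
      = 2 * Real.pi * Complex.I * (ξ i : ℝ) * (𝓕 u.toL2 : L2 d) ξ := by
  have h : ∂_{EuclideanSpace.single i (1 : ℝ)} (Lp.toTemperedDistribution u.toL2 : 𝓢'(Space d, ℂ))
      = Lp.toTemperedDistribution (u.partialDeriv i) := u.2 i
  apply_fun (fun w => 𝓕 w) at h
  rw [TemperedDistribution.fourier_lineDerivOp_eq, Lp.fourier_toTemperedDistribution_eq,
    Lp.fourier_toTemperedDistribution_eq] at h
  set F : L2 d := 𝓕 u.toL2
  set G : L2 d := 𝓕 (u.partialDeriv i)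
  -- a smooth bounded weight `w` such that `ξᵢ w` is bounded as well
  set w : Space d → ℂ := fun ξ => (((1 + ‖ξ‖ ^ 2) ^ (-1 : ℝ) : ℝ) : ℂ) with hw
  set m : Space d → ℂ := fun ξ => ((inner ℝ ξ (EuclideanSpace.single i (1 : ℝ)) : ℝ) : ℂ) with hm
  have hwt : w.HasTemperateGrowth := by fun_prop
  have hmt : m.HasTemperateGrowth := by fun_prop
  have hwmt : (w * m).HasTemperateGrowth := by
    have : (fun ξ => w ξ * m ξ).HasTemperateGrowth := by fun_prop
    exact this
  have hwn : ∀ ξ, ‖w ξ‖ = (1 + ‖ξ‖ ^ 2)⁻¹ := by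
    intro ξ
    rw [hw, Complex.norm_real, Real.rpow_neg_one, Real.norm_of_nonneg (by positivity)]
  have hwb : MemLp w ∞ (volume : Measure (Space d)) := by
    refine memLp_top_of_bound hwt.1.continuous.aestronglyMeasurable 1 (ae_of_all _ fun ξ => ?_)
    rw [hwn]
    exact inv_le_one_of_one_le₀ (by nlinarith [sq_nonneg ‖ξ‖])
  have hwmb : MemLp (w * m) ∞ (volume : Measure (Space d)) := by
    refine memLp_top_of_bound hwmt.1.continuous.aestronglyMeasurable 1 (ae_of_all _ fun ξ => ?_)
    rw [Pi.mul_apply, norm_mul, hwn, hm, Complex.norm_real]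
    have h1 : ‖inner ℝ ξ (EuclideanSpace.single i (1 : ℝ))‖ ≤ ‖ξ‖ := by
      simpa using norm_inner_le_norm (𝕜 := ℝ) ξ (EuclideanSpace.single i (1 : ℝ))
    rw [inv_mul_le_iff₀ (by positivity)]
    nlinarith [sq_nonneg (‖ξ‖ - 1), sq_nonneg ‖ξ‖]
  have h2 := congrArg (TemperedDistribution.smulLeftCLM ℂ w) h
  simp only [map_smul] at h2
  rw [TemperedDistribution.smulLeftCLM_smulLeftCLM_apply hmt hwt, mul_comm m w,
    ← Lp.toTemperedDistribution_smul_eq (r := 2) hwmt hwmb,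
    ← Lp.toTemperedDistribution_smul_eq (r := 2) hwt hwb] at h2
  simp only [← Lp.toTemperedDistributionCLM_apply, ← map_smul] at h2
  have h3 := LinearMap.ker_eq_bot.1
    (Lp.ker_toTemperedDistributionCLM_eq_bot (F := ℂ) (μ := (volume : Measure (Space d)))
      (p := 2)) h2
  have h4 := Lp.coeFn_lpSMul (r := 2) (hwmb.toLp _) F
  have h5 := Lp.coeFn_lpSMul (r := 2) (hwb.toLp _) G
  have h6 := Lp.coeFn_smul (2 * Real.pi * Complex.I) ((hwmb.toLp _) • F : L2 d)
  rw [h3] at h6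
  filter_upwards [h4, h5, h6, hwmb.coeFn_toLp, hwb.coeFn_toLp] with ξ e4 e5 e6 e7 e8
  rw [e5] at e6
  simp only [Pi.smul_apply, smul_eq_mul] at e6
  rw [e4] at e6
  simp only [Pi.smul_apply', smul_eq_mul, e7, e8, Pi.mul_apply] at e6
  have hw0 : w ξ ≠ 0 := by
    rw [← norm_ne_zero_iff, hwn]
    positivity
  have hmi : m ξ = (ξ i : ℝ) := by
    simp [hm, EuclideanSpace.inner_single_right]
  rw [hmi] at e6
  apply mul_left_cancel₀ hw0
  rw [e6]
  ring

/-- For an `H¹` function and `0 ≤ σ ≤ 1/2`, the function `|ξ|^{2σ} û(ξ)` is in `L²`. -/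
theorem memLp_fracSymbolMul {σ : ℝ} (h0 : 0 ≤ σ) (h1 : σ ≤ 1 / 2) (u : H1 d) :
    MemLp (fracSymbolMul σ u.toL2) 2 volume := by
  have hG : MemLp (fun ξ => ‖(𝓕 u.toL2 : L2 d) ξ‖
      + ∑ i, ‖(𝓕 (u.partialDeriv i) : L2 d) ξ‖) 2 (volume : Measure (Space d)) :=
    (Lp.memLp _).norm.add (memLp_finsetSum _ fun i _ => (Lp.memLp _).norm)
  refine hG.mono' ?_ ?_
  · refine AEStronglyMeasurable.mul ?_ (Lp.aestronglyMeasurable _)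
    exact (by fun_prop : Measurable fun ξ : Space d =>
      (((2 * Real.pi * ‖ξ‖) ^ (2 * σ) : ℝ) : ℂ)).aestronglyMeasurable
  filter_upwards [ae_all_iff.2 fun i => fourier_partialDeriv_ae u i] with ξ hξ
  have hr : 0 ≤ 2 * Real.pi * ‖ξ‖ := by positivity
  have hpow : (2 * Real.pi * ‖ξ‖) ^ (2 * σ) ≤ 1 + 2 * Real.pi * ‖ξ‖ := by
    rcases le_total (2 * Real.pi * ‖ξ‖) 1 with h | h
    · exact (Real.rpow_le_one hr h (by linarith)).trans (by linarith)
    · exact (Real.rpow_le_rpow_of_exponent_le h (by linarith : 2 * σ ≤ 1)).trans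
        (by rw [Real.rpow_one]; linarith)
  have hsum : ‖ξ‖ ≤ ∑ i, ‖ξ i‖ := by
    rw [EuclideanSpace.norm_eq]
    refine Real.sqrt_le_iff.2 ⟨Finset.sum_nonneg fun i _ => norm_nonneg _, ?_⟩
    exact Finset.sum_sq_le_sq_sum_of_nonneg fun i _ => norm_nonneg _
  have hpi : ∀ i, ‖(𝓕 (u.partialDeriv i) : L2 d) ξ‖
      = 2 * Real.pi * ‖ξ i‖ * ‖(𝓕 u.toL2 : L2 d) ξ‖ := by
    intro i
    rw [hξ i]
    simp [abs_of_pos Real.pi_pos]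
  rw [fracSymbolMul, norm_mul, Complex.norm_real, Real.norm_of_nonneg (Real.rpow_nonneg hr _)]
  simp only [hpi]
  rw [← Finset.sum_mul, ← Finset.mul_sum]
  have h3 : 0 ≤ ‖(𝓕 u.toL2 : L2 d) ξ‖ := norm_nonneg _
  calc _ ≤ (1 + 2 * Real.pi * ∑ i, ‖ξ i‖) * ‖(𝓕 u.toL2 : L2 d) ξ‖ := by
        gcongr
        refine hpow.trans ?_
        gcongr
    _ = _ := by ring

/-- The energy form
`B(u, v) = ∫ a ∇u · conj ∇v + ∫ b (-Δ)^{s/2}u conj((-Δ)^{s/2}v) + ∫ c u conj v`. -/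
def energyForm (s : ℝ) (a b c : Linf d) (u v : H1 d) : ℂ :=
  (∫ x, (a x : ℂ) * ∑ i, u.partialDeriv i x * conj (v.partialDeriv i x))
    + (∫ x, (b x : ℂ) * (fracLaplacian (s / 2) u.toL2 x * conj (fracLaplacian (s / 2) v.toL2 x)))
    + ∫ x, (c x : ℂ) * (u.toL2 x * conj (v.toL2 x))

/-- Lebesgue measure on the time interval `(0, T)`. -/
abbrev timeMeasure (T : ℝ) : Measure ℝ := volume.restrict (Ioo 0 T)

/-- The Bochner space `L²(0, T; H¹(ℝ^d))`. -/
abbrev L2H1 (d : ℕ) (T : ℝ) : Type := Lp (H1 d) 2 (timeMeasure T)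

/-- The Bochner space `L²(0, T; (H¹(ℝ^d))')`. -/
abbrev L2H1Dual (d : ℕ) (T : ℝ) : Type := Lp (H1Dual d) 2 (timeMeasure T)

/-- The space `C([0, T]; L²(ℝ^d))` with the supremum norm. -/
abbrev CL2 (d : ℕ) (T : ℝ) : Type := C(Icc (0 : ℝ) T, L2 d)

/-- `g = u_t` in the sense of `(H¹)'`-valued distributions on `(0, T)`, for the Gelfand triple
`H¹ ⊆ L² ⊆ (H¹)'`: `∫ η' (u, φ)_{L²} dt = - ∫ η ⟨g, φ⟩ dt` for all `η ∈ C_c^∞(0, T)`, `φ ∈ H¹`.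
Here `(u, φ)_{L²} = ∫ u conj φ`, which is `inner ℂ φ u`. -/
def IsWeakTimeDeriv {T : ℝ} (u : L2H1 d T) (g : L2H1Dual d T) : Prop :=
  ∀ η : ℝ → ℝ, ContDiff ℝ ∞ η → HasCompactSupport η → tsupport η ⊆ Ioo 0 T → ∀ φ : H1 d,
    ∫ t, ((deriv η t : ℝ) : ℂ) * inner ℂ φ.toL2 (u t).toL2 ∂(timeMeasure T)
      = -∫ t, ((η t : ℝ) : ℂ) * g t φ ∂(timeMeasure T)

/-- `U` is the representative of `u ∈ L²(0, T; H¹)` in `C([0, T]; L²)`. -/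
def IsContRep {T : ℝ} (u : L2H1 d T) (U : CL2 d T) : Prop :=
  ∀ᵐ t ∂(timeMeasure T), ∀ ht : t ∈ Icc (0 : ℝ) T, U ⟨t, ht⟩ = (u t).toL2

/-- `u` is a weak solution on `(0, T) × ℝ^d` of
`u_t - ∇·(a ∇u) + (-Δ)^{s/2}(b (-Δ)^{s/2} u) + c u = 0`, `u(0) = u₀`. -/
structure IsWeakSolution {T : ℝ} (hT : 0 < T) (s : ℝ) (a b c : Linf d) (u₀ : H1 d)
    (u : L2H1 d T) : Prop where
  /-- The initial condition, which refers to the representative of `u` in `C([0, T]; L²)`. -/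
  initial : ∃ U : CL2 d T, IsContRep u U ∧ U ⟨0, left_mem_Icc.2 hT.le⟩ = u₀.toL2
  /-- `u_t ∈ L²(0, T; (H¹)')`, and the weak form of the equation. -/
  equation : ∃ g : L2H1Dual d T, IsWeakTimeDeriv u g ∧
    ∀ᵐ t ∂(timeMeasure T), ∀ φ : H1 d, g t φ + energyForm s a b c (u t) φ = 0

end MixedHeat

end

/-! The proof is an energy estimate for the difference `w = uε - u`. Subtracting the two equations
so that the coefficient error falls on the fixed solution `u` gives `w_t + Bε(w, ·) = -(Bε - B)(u,
·)`. The form `Bε` is coercive on `H¹` with constant `m = min a₀ c₀`, independent of `ε`, and `|(Bε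
- B)(u, w)| ≤ δ ‖u‖ ‖w‖` with `δ = d ‖aε - a‖ + ‖bε - b‖ + ‖cε - c‖`. Testing with `w` and applying
Young's inequality yields `d/dt ‖w‖²_{L²} + m ‖w‖²_{H¹} ≤ (δ²/m) ‖u‖²_{H¹}` (`re_apply_sub_le`).
Integrating in time controls both norms by the initial error and `δ` (`stability_estimate`). Neither
Gronwall's lemma nor a uniform bound on `uε` is needed.

The delicate point is the chain rule `d/dt ‖w‖² = 2 Re ⟨w_t, w⟩`, since `w_t` takes values only in
the antidual (`energy_identity`). Testing with smoothed indicators first turns the distributional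
derivative into increments: `(U(t) - U(s), φ) = ∫ₛᵗ ⟨g, φ⟩` (`sub_eq_integral_of_forall_test`). Then
`‖U(r+h)‖² - ‖U(r)‖² = Re (U(r+h) + U(r), U(r+h) - U(r))` is, for a.e. `r`, the integral of `g` over
`[r, r+h]` tested with `W(r+h) + W(r)`, where `W` is the `H¹`-valued function represented by `U`.
Averaging over `r`, dividing by `h` and using continuity of translations in `L²` gives the identity
as `h → 0⁺`, without mollification.

The fractional term is bounded on `H¹` by Plancherel and `|ξ|^{2s} ≤ 1 + |ξ|²`. It is nonnegative,
so coercivity does not need it. -/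

noncomputable section

namespace MixedHeat

/-! ### Smooth cut-offs, and distributional derivatives in integrated form -/

/-- The derivative of the smooth transition function vanishes off `[0, 1]`. -/
theorem deriv_smoothTransition_eq_zero {x : ℝ} (hx : x ∉ Icc (0 : ℝ) 1) :
    deriv Real.smoothTransition x = 0 := by
  rw [mem_Icc, not_and_or, not_le, not_le] at hx
  rcases hx with hx | hx
  · have : Real.smoothTransition =ᶠ[𝓝 x] fun _ => 0 := by
      filter_upwards [Iio_mem_nhds hx] with y hy using
        Real.smoothTransition.zero_of_nonpos (le_of_lt hy)
    rw [this.deriv_eq, deriv_const]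
  · have : Real.smoothTransition =ᶠ[𝓝 x] fun _ => 1 := by
      filter_upwards [Ioi_mem_nhds hx] with y hy using
        Real.smoothTransition.one_of_one_le (le_of_lt hy)
    rw [this.deriv_eq, deriv_const]

theorem continuous_deriv_smoothTransition : Continuous (deriv Real.smoothTransition) :=
  (Real.smoothTransition.contDiff (n := 1)).continuous_deriv le_rfl

theorem hasCompactSupport_deriv_smoothTransition :
    HasCompactSupport (deriv Real.smoothTransition) :=
  HasCompactSupport.intro isCompact_Icc fun _ hx => deriv_smoothTransition_eq_zero hx

theorem integral_deriv_smoothTransition : ∫ x, deriv Real.smoothTransition x = 1 := by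
  have h1 : ∫ x in (0 : ℝ)..1, deriv Real.smoothTransition x = 1 := by
    rw [intervalIntegral.integral_deriv_eq_sub' Real.smoothTransition rfl]
    · simp
    · exact fun x _ => (Real.smoothTransition.contDiffAt (n := 1)).differentiableAt (by simp)
    · exact continuous_deriv_smoothTransition.continuousOn
  rw [intervalIntegral.integral_of_le zero_le_one, ← integral_Icc_eq_integral_Ioc,
    setIntegral_eq_integral_of_forall_compl_eq_zero
      fun x hx => deriv_smoothTransition_eq_zero hx] at h1
  exact h1

/-- The rescaled derivatives of the smooth transition function approximate the point mass. -/
theorem tendsto_integral_deriv_smoothTransition_mul {f : ℝ → ℂ} (hf : Continuous f) {C : ℝ}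
    (hC : ∀ x, ‖f x‖ ≤ C) (s : ℝ) :
    Tendsto (fun δ : ℝ => ∫ r, ((δ⁻¹ * deriv Real.smoothTransition (δ⁻¹ * (r - s)) : ℝ) : ℂ) * f r)
      (𝓝[>] 0) (𝓝 (f s)) := by
  have h1 : ∀ δ > (0 : ℝ),
      ∫ r, ((δ⁻¹ * deriv Real.smoothTransition (δ⁻¹ * (r - s)) : ℝ) : ℂ) * f r
        = ∫ x, ((deriv Real.smoothTransition x : ℝ) : ℂ) * f (δ * x + s) := by
    intro δ hδ
    have e1 := integral_sub_right_eq_self (μ := volume) (fun r : ℝ =>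
      ((δ⁻¹ * deriv Real.smoothTransition (δ⁻¹ * r) : ℝ) : ℂ) * f (r + s)) s
    simp only [sub_add_cancel] at e1
    rw [e1]
    have e2 := Measure.integral_comp_mul_left
      (fun x : ℝ => ((deriv Real.smoothTransition x : ℝ) : ℂ) * f (δ * x + s)) δ⁻¹
    simp only [mul_inv_cancel_left₀ hδ.ne', inv_inv, abs_of_pos hδ] at e2
    simp only [Complex.ofReal_mul, mul_assoc]
    rw [integral_const_mul, e2, Complex.real_smul, ← mul_assoc, ← Complex.ofReal_mul,
      inv_mul_cancel₀ hδ.ne', Complex.ofReal_one, one_mul]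
  have h2 : ∫ x, ((deriv Real.smoothTransition x : ℝ) : ℂ) * f s = f s := by
    rw [integral_mul_const, integral_complex_ofReal, integral_deriv_smoothTransition]
    simp
  have hk : Integrable fun x => ‖deriv Real.smoothTransition x‖ :=
    (continuous_deriv_smoothTransition.integrable_of_hasCompactSupport
      hasCompactSupport_deriv_smoothTransition).norm
  rw [← h2]
  refine Tendsto.congr' (f₁ := fun δ : ℝ =>
    ∫ x, ((deriv Real.smoothTransition x : ℝ) : ℂ) * f (δ * x + s)) ?_ ?_
  · filter_upwards [self_mem_nhdsWithin] with δ hδ using (h1 δ hδ).symm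
  refine tendsto_integral_filter_of_dominated_convergence
    (fun x => ‖deriv Real.smoothTransition x‖ * C) ?_ ?_ (hk.mul_const C) ?_
  · refine Eventually.of_forall fun δ => Continuous.aestronglyMeasurable ?_
    have := continuous_deriv_smoothTransition
    fun_prop
  · refine Eventually.of_forall fun δ => ae_of_all _ fun x => ?_
    rw [norm_mul, Complex.norm_real]
    gcongr
    exact hC _
  · refine ae_of_all _ fun x => Tendsto.const_mul _ ?_
    have : Continuous fun δ : ℝ => f (δ * x + s) := by fun_prop
    simpa using (this.tendsto 0).mono_left nhdsWithin_le_nhds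

/-- At `r = s` the value is `0` for every `δ`, hence the strict inequality in the limit. The
difference of two such limits is the indicator of `(s, t]`. -/
theorem tendsto_smoothTransition_comp_inv_mul {s r : ℝ} :
    Tendsto (fun δ : ℝ => Real.smoothTransition (δ⁻¹ * (r - s))) (𝓝[>] 0)
      (𝓝 (if s < r then 1 else 0)) := by
  split_ifs with h
  · refine tendsto_const_nhds.congr' ?_
    have h0 : (0 : ℝ) < r - s := sub_pos.2 h
    filter_upwards [Ioc_mem_nhdsGT h0] with δ hδ
    refine (Real.smoothTransition.one_of_one_le ?_).symm
    rw [← div_eq_inv_mul, one_le_div hδ.1]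
    exact hδ.2
  · refine tendsto_const_nhds.congr' ?_
    filter_upwards [self_mem_nhdsWithin] with δ hδ
    refine (Real.smoothTransition.zero_of_nonpos ?_).symm
    exact mul_nonpos_of_nonneg_of_nonpos (inv_nonneg.2 (le_of_lt hδ))
      (by linarith [not_lt.1 h])

/-- A continuous function with an integrable distributional derivative on `(0, T)` is the
integral of that derivative. -/
theorem sub_eq_integral_of_forall_test {T : ℝ} {f g : ℝ → ℂ} (hf : Continuous f) {C : ℝ}
    (hC : ∀ x, ‖f x‖ ≤ C) (hg : IntegrableOn g (Ioo 0 T))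
    (h : ∀ η : ℝ → ℝ, ContDiff ℝ ∞ η → HasCompactSupport η → tsupport η ⊆ Ioo 0 T →
      ∫ t in Ioo 0 T, ((deriv η t : ℝ) : ℂ) * f t = -∫ t in Ioo 0 T, ((η t : ℝ) : ℂ) * g t)
    {s t : ℝ} (hs : 0 < s) (hst : s ≤ t) (ht : t < T) :
    f t - f s = ∫ r in s..t, g r := by
  -- A smoothed indicator of `(s, t]`: it rises on `[s, s + δ]` and falls on `[t, t + δ]`, so it is
  -- an admissible test function once `δ < T - t`. Its derivative approximates the point mass at `s`
  -- minus that at `t`.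
  set η : ℝ → ℝ → ℝ := fun δ r =>
    Real.smoothTransition (δ⁻¹ * (r - s)) - Real.smoothTransition (δ⁻¹ * (r - t)) with hη
  have hS : Differentiable ℝ Real.smoothTransition :=
    (Real.smoothTransition.contDiff (n := 1)).differentiable (by simp)
  have hηs : ∀ δ, ContDiff ℝ ∞ (η δ) := by
    intro δ
    have h1 : ContDiff ℝ ∞ Real.smoothTransition := Real.smoothTransition.contDiff (n := ⊤)
    exact (h1.comp (by fun_prop)).sub (h1.comp (by fun_prop))
  have hηz : ∀ δ > 0, ∀ r, r ∉ Icc s (t + δ) → η δ r = 0 := by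
    intro δ hδ r hr
    rw [mem_Icc, not_and_or, not_le, not_le] at hr
    rcases hr with hr | hr
    · have h1 : δ⁻¹ * (r - s) ≤ 0 :=
        mul_nonpos_of_nonneg_of_nonpos (inv_nonneg.2 hδ.le) (by linarith)
      have h2 : δ⁻¹ * (r - t) ≤ 0 :=
        mul_nonpos_of_nonneg_of_nonpos (inv_nonneg.2 hδ.le) (by linarith)
      simp [hη, Real.smoothTransition.zero_of_nonpos h1, Real.smoothTransition.zero_of_nonpos h2]
    · have h1 : 1 ≤ δ⁻¹ * (r - s) := by
        rw [← div_eq_inv_mul, one_le_div hδ]; linarith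
      have h2 : 1 ≤ δ⁻¹ * (r - t) := by
        rw [← div_eq_inv_mul, one_le_div hδ]; linarith
      simp [hη, Real.smoothTransition.one_of_one_le h1, Real.smoothTransition.one_of_one_le h2]
  have hd : ∀ δ r, deriv (η δ) r = δ⁻¹ * deriv Real.smoothTransition (δ⁻¹ * (r - s))
      - δ⁻¹ * deriv Real.smoothTransition (δ⁻¹ * (r - t)) := by
    intro δ r
    have key : ∀ x : ℝ, HasDerivAt (fun r => Real.smoothTransition (δ⁻¹ * (r - x)))
        (δ⁻¹ * deriv Real.smoothTransition (δ⁻¹ * (r - x))) r := by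
      intro x
      have h1 := ((hasDerivAt_id r).sub_const x).const_mul δ⁻¹
      have h2 := (hS (δ⁻¹ * (r - x))).hasDerivAt.comp r h1
      simpa [mul_comm, Function.comp_def] using h2
    exact ((key s).sub (key t)).deriv
  have hη1 : ∀ δ r, ‖η δ r‖ ≤ 1 := by
    intro δ r
    rw [Real.norm_eq_abs, abs_le]
    constructor <;>
    linarith [Real.smoothTransition.nonneg (δ⁻¹ * (r - s)),
      Real.smoothTransition.nonneg (δ⁻¹ * (r - t)), Real.smoothTransition.le_one (δ⁻¹ * (r - s)),
      Real.smoothTransition.le_one (δ⁻¹ * (r - t))]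
  have hL : Tendsto (fun δ => ∫ r, ((deriv (η δ) r : ℝ) : ℂ) * f r) (𝓝[>] 0) (𝓝 (f s - f t)) := by
    refine ((tendsto_integral_deriv_smoothTransition_mul hf hC s).sub
      (tendsto_integral_deriv_smoothTransition_mul hf hC t)).congr' ?_
    filter_upwards [self_mem_nhdsWithin] with δ hδ
    have hi : ∀ x : ℝ, Integrable fun r =>
        ((δ⁻¹ * deriv Real.smoothTransition (δ⁻¹ * (r - x)) : ℝ) : ℂ) * f r := by
      intro x
      have := continuous_deriv_smoothTransition
      refine Continuous.integrable_of_hasCompactSupport (by fun_prop) ?_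
      refine HasCompactSupport.intro (K := Icc x (x + δ)) isCompact_Icc fun r hr => ?_
      rw [deriv_smoothTransition_eq_zero]
      · simp
      · contrapose! hr
        have hδ' : (0 : ℝ) < δ := hδ
        rw [← div_eq_inv_mul] at hr
        have h1 := hr.1
        have h2 := hr.2
        rw [le_div_iff₀ hδ'] at h1
        rw [div_le_iff₀ hδ'] at h2
        constructor <;> linarith
    rw [← integral_sub (hi s) (hi t)]
    congr 1
    ext r
    rw [hd]
    push_cast
    ring
  have hR : Tendsto (fun δ => -∫ r in Ioo 0 T, ((η δ r : ℝ) : ℂ) * g r) (𝓝[>] 0)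
      (𝓝 (-∫ r in s..t, g r)) := by
    refine Tendsto.neg ?_
    have e : ∫ r in s..t, g r = ∫ r in Ioo 0 T,
        ((((if s < r then 1 else 0) - (if t < r then 1 else 0) : ℝ)) : ℂ) * g r := by
      rw [intervalIntegral.integral_of_le hst, ← integral_indicator measurableSet_Ioc,
        ← integral_indicator measurableSet_Ioo]
      congr 1
      ext r
      simp only [indicator, mem_Ioc, mem_Ioo]
      split_ifs <;> first | (simp; done) | (exfalso; grind)
    rw [e]
    refine tendsto_integral_filter_of_dominated_convergence (fun r => ‖g r‖) ?_ ?_ hg.norm ?_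
    · refine Eventually.of_forall fun δ => AEStronglyMeasurable.mul ?_ hg.aestronglyMeasurable
      exact (Complex.continuous_ofReal.comp (hηs δ).continuous).aestronglyMeasurable
    · refine Eventually.of_forall fun δ => ae_of_all _ fun r => ?_
      rw [norm_mul, Complex.norm_real]
      exact mul_le_of_le_one_left (norm_nonneg _) (hη1 δ r)
    · refine ae_of_all _ fun r => Tendsto.mul_const _ ?_
      exact (Complex.continuous_ofReal.tendsto _).comp
        (tendsto_smoothTransition_comp_inv_mul.sub tendsto_smoothTransition_comp_inv_mul)
  have hE : ∀ᶠ δ in 𝓝[>] (0 : ℝ), ∫ r, ((deriv (η δ) r : ℝ) : ℂ) * f r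
      = -∫ r in Ioo 0 T, ((η δ r : ℝ) : ℂ) * g r := by
    filter_upwards [Ioo_mem_nhdsGT (sub_pos.2 ht)] with δ hδ
    have hts : tsupport (η δ) ⊆ Icc s (t + δ) := by
      refine closure_minimal (fun r hr => ?_) isClosed_Icc
      by_contra hr'
      exact hr (hηz δ hδ.1 r hr')
    have hts' : tsupport (η δ) ⊆ Ioo 0 T :=
      hts.trans fun r hr => ⟨hs.trans_le hr.1, hr.2.trans_lt (by linarith [hδ.2])⟩
    rw [← h (η δ) (hηs δ) (HasCompactSupport.intro isCompact_Icc (hηz δ hδ.1)) hts',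
      setIntegral_eq_integral_of_forall_compl_eq_zero]
    intro r hr
    have : deriv (η δ) r = 0 := by
      by_contra hne
      exact hr (hts' (support_deriv_subset hne))
    simp [this]
  have := tendsto_nhds_unique (hL.congr' hE) hR
  linear_combination -this

/-! ### Lions' energy identity in an abstract triple -/

section Energy

variable {V H : Type*} [NormedAddCommGroup V] [NormedSpace ℂ V]
  [NormedAddCommGroup H] [InnerProductSpace ℂ H]

variable (V) in
/-- The real part of the duality pairing between the antidual of `V` and `V`. -/
def rePairing : (V →L⋆[ℂ] ℂ) →L[ℝ] V →L[ℝ] ℝ :=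
  LinearMap.mkContinuous₂
    (LinearMap.mk₂ ℝ (fun (G : V →L⋆[ℂ] ℂ) (v : V) => (G v).re)
      (fun G G' v => by simp) (fun c G v => by simp)
      (fun G v v' => by simp)
      (fun c G v => by
        rw [← Complex.coe_smul, map_smulₛₗ]
        simp)) 1
    (fun G v => by
      simp only [LinearMap.mk₂_apply, one_mul]
      exact (Complex.abs_re_le_norm _).trans (G.le_opNorm v))

@[simp]
theorem rePairing_apply (G : V →L⋆[ℂ] ℂ) (v : V) : rePairing V G v = (G v).re := rfl

theorem abs_rePairing_le (G : V →L⋆[ℂ] ℂ) (v : V) : |(G v).re| ≤ ‖G‖ ^ 2 + ‖v‖ ^ 2 := by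
  refine ((Complex.abs_re_le_norm _).trans (G.le_opNorm v)).trans ?_
  nlinarith [sq_nonneg (‖G‖ - ‖v‖), sq_nonneg ‖G‖, sq_nonneg ‖v‖]

theorem continuous_translate_Lp {E : Type*} [NormedAddCommGroup E]
    (f : Lp E 2 (volume : Measure ℝ)) :
    Continuous fun y : ℝ => Lp.compMeasurePreserving (fun r : ℝ => r + y)
      (measurePreserving_add_right volume y) f := by
  let g : C(ℝ, C(ℝ, ℝ)) := (ContinuousMap.mk (fun a : ℝ × ℝ => a.2 + a.1) (by fun_prop)).curry
  exact (continuous_const (y := f)).compMeasurePreservingLp g.continuous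
    (fun y => measurePreserving_add_right volume y) (by simp)

theorem memLp_translate {E : Type*} [NormedAddCommGroup E] {f : ℝ → E} (hf : MemLp f 2 volume)
    (y : ℝ) : MemLp (fun r => f (r + y)) 2 volume :=
  hf.comp_measurePreserving (measurePreserving_add_right volume y)

/-- Translation is continuous in `L²(ℝ)` and the `L²` pairing is bounded bilinear. The two shifts
are independent because the energy identity shifts `G` by `h θ` and `W` by `h`. -/
theorem continuous_integral_translate {G : ℝ → V →L⋆[ℂ] ℂ} {W : ℝ → V}
    (hG : MemLp G 2 volume) (hW : MemLp W 2 volume) (S : Set ℝ) :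
    Continuous fun p : ℝ × ℝ => ∫ r in S, (G (r + p.1) (W (r + p.2) + W r)).re := by
  let RG := LpToLpRestrictCLM ℝ (V →L⋆[ℂ] ℂ) ℝ volume 2 S
  let RW := LpToLpRestrictCLM ℝ V ℝ volume 2 S
  let τG : ℝ → Lp (V →L⋆[ℂ] ℂ) 2 (volume : Measure ℝ) := fun y =>
    Lp.compMeasurePreserving (fun r : ℝ => r + y) (measurePreserving_add_right volume y)
      (hG.toLp G)
  let τW : ℝ → Lp V 2 (volume : Measure ℝ) := fun y =>
    Lp.compMeasurePreserving (fun r : ℝ => r + y) (measurePreserving_add_right volume y)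
      (hW.toLp W)
  have hτG : Continuous τG := continuous_translate_Lp _
  have hτW : Continuous τW := continuous_translate_Lp _
  have h : (fun p : ℝ × ℝ => ∫ r in S, (G (r + p.1) (W (r + p.2) + W r)).re)
      = fun p => (rePairing V).lpPairing (volume.restrict S) 2 2 (RG (τG p.1))
        (RW (τW p.2 + hW.toLp W)) := by
    ext p
    rw [ContinuousLinearMap.lpPairing_eq_integral]
    have eG : ∀ᵐ r, τG p.1 r = G (r + p.1) :=
      (Lp.coeFn_compMeasurePreserving _ _).trans
        ((measurePreserving_add_right volume p.1).quasiMeasurePreserving.ae_eq_comp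
          hG.coeFn_toLp)
    have eW : ∀ᵐ r, τW p.2 r = W (r + p.2) :=
      (Lp.coeFn_compMeasurePreserving _ _).trans
        ((measurePreserving_add_right volume p.2).quasiMeasurePreserving.ae_eq_comp
          hW.coeFn_toLp)
    refine integral_congr_ae ?_
    filter_upwards [LpToLpRestrictCLM_coeFn ℝ S (τG p.1),
      LpToLpRestrictCLM_coeFn ℝ S (τW p.2 + hW.toLp W), ae_restrict_of_ae eG,
      ae_restrict_of_ae eW, ae_restrict_of_ae hW.coeFn_toLp,
      ae_restrict_of_ae (Lp.coeFn_add (τW p.2) (hW.toLp W))] with r h1 h2 h3 h4 h5 h6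
    rw [h1, h2, h6, Pi.add_apply, h3, h4, h5, rePairing_apply]
  rw [h]
  fun_prop

theorem stronglyMeasurable_re_apply {α : Type*} [MeasurableSpace α] {G : α → V →L⋆[ℂ] ℂ}
    {W : α → V} (hG : StronglyMeasurable G) (hW : StronglyMeasurable W) :
    StronglyMeasurable fun x => (G x (W x)).re := by
  have : Continuous fun p : (V →L⋆[ℂ] ℂ) × V => rePairing V p.1 p.2 := by fun_prop
  exact this.comp_stronglyMeasurable (hG.prodMk hW)

theorem integrable_re_apply {α : Type*} [MeasurableSpace α] {μ : Measure α}
    {G : α → V →L⋆[ℂ] ℂ} {W : α → V} (hG : MemLp G 2 μ) (hW : MemLp W 2 μ) :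
    Integrable (fun x => (G x (W x)).re) μ := by
  have hc : Continuous fun p : (V →L⋆[ℂ] ℂ) × V => rePairing V p.1 p.2 := by fun_prop
  refine Integrable.mono' ((hG.integrable_norm_pow two_ne_zero).add
    (hW.integrable_norm_pow two_ne_zero))
    (hc.comp_aestronglyMeasurable (hG.aestronglyMeasurable.prodMk hW.aestronglyMeasurable)) ?_
  exact ae_of_all _ fun x => abs_rePairing_le _ _

/-- The shear `(r, θ) ↦ r + h θ` pulls back integrable functions to functions that are integrable
on products with a bounded interval. -/
theorem integrable_comp_shear {N : ℝ → ℝ} (hN : Integrable N) (hNm : StronglyMeasurable N)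
    (h : ℝ) (S : Set ℝ) :
    Integrable (fun p : ℝ × ℝ => N (p.1 + h * p.2))
      ((volume.restrict S).prod (volume.restrict (Ioc (0 : ℝ) 1))) := by
  have hm : StronglyMeasurable fun p : ℝ × ℝ => N (p.1 + h * p.2) :=
    hNm.comp_measurable (by fun_prop)
  rw [integrable_prod_iff' hm.aestronglyMeasurable]
  -- For each fixed `θ` the shear is a translation in `r`, so the integral of the norm over `S` is
  -- at most `∫ ‖N‖`, uniformly in `θ`.
  refine ⟨ae_of_all _ fun θ => (hN.comp_add_right (h * θ)).integrableOn, ?_⟩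
  refine Integrable.mono' (integrable_const (∫ r, ‖N r‖)) ?_ (ae_of_all _ fun θ => ?_)
  · exact (hm.norm.integral_prod_left (μ := volume.restrict S)).aestronglyMeasurable
  · rw [Real.norm_of_nonneg (integral_nonneg fun _ => norm_nonneg _)]
    refine (setIntegral_le_integral (hN.comp_add_right (h * θ)).norm
      (ae_of_all _ fun _ => norm_nonneg _)).trans ?_
    exact (integral_add_right_eq_self (fun r => ‖N r‖) (h * θ)).le

theorem tendsto_average_right {f : ℝ → ℝ} (hf : Continuous f) (t : ℝ) :
    Tendsto (fun h : ℝ => h⁻¹ * ∫ r in t..t + h, f r) (𝓝[>] 0) (𝓝 (f t)) := by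
  have h1 : HasDerivAt (fun x => ∫ r in t..x, f r) (f t) t :=
    intervalIntegral.integral_hasDerivAt_right (hf.intervalIntegrable _ _)
      hf.aestronglyMeasurable.stronglyMeasurableAtFilter hf.continuousAt
  have h2 := (hasDerivAt_iff_tendsto_slope_zero.1 h1).mono_left
    (nhdsWithin_mono 0 (fun x (hx : x ∈ Ioi (0 : ℝ)) => (mem_Ioi.1 hx).ne'))
  simpa using h2

/-- The energy identity of Lions on a compact subinterval of `(0, T)`. -/
theorem energy_identity_Ioo {J : V → H} (hJ : ∀ v w, J (v + w) = J v + J w) {T : ℝ}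
    {G : ℝ → V →L⋆[ℂ] ℂ} {W : ℝ → V}
    {U : ℝ → H} (hG : MemLp G 2 volume) (hW : MemLp W 2 volume) (hGm : StronglyMeasurable G)
    (hWm : StronglyMeasurable W) (hU : Continuous U)
    (hUW : ∀ᵐ r, r ∈ Ioo 0 T → U r = J (W r))
    (hint : ∀ φ s t, 0 < s → s ≤ t → t < T →
      inner ℂ (J φ) (U t) - inner ℂ (J φ) (U s) = ∫ r in s..t, G r φ)
    {s t : ℝ} (hs : 0 < s) (hst : s ≤ t) (ht : t < T) :
    ‖U t‖ ^ 2 - ‖U s‖ ^ 2 = 2 * ∫ r in s..t, (G r (W r)).re := by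
  set P : ℝ × ℝ → ℝ := fun p => ∫ r in Ioc s t, (G (r + p.1) (W (r + p.2) + W r)).re with hPdef
  have hP : Continuous P := continuous_integral_translate hG hW _
  have hN : Continuous fun r => ‖U r‖ ^ 2 := by fun_prop
  -- The integrals over `[s + h, t]` cancel, leaving the averages of `‖U‖²` over `[t, t + h]` and
  -- `[s, s + h]`.
  have hL : Tendsto (fun h : ℝ => h⁻¹ * ∫ r in s..t, (‖U (r + h)‖ ^ 2 - ‖U r‖ ^ 2)) (𝓝[>] 0)
      (𝓝 (‖U t‖ ^ 2 - ‖U s‖ ^ 2)) := by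
    refine ((tendsto_average_right hN t).sub (tendsto_average_right hN s)).congr fun h => ?_
    have hi : ∀ x y : ℝ, IntervalIntegrable (fun r => ‖U r‖ ^ 2) volume x y :=
      fun x y => hN.intervalIntegrable x y
    rw [intervalIntegral.integral_sub
      ((by fun_prop : Continuous fun r => ‖U (r + h)‖ ^ 2).intervalIntegrable _ _) (hi _ _),
      intervalIntegral.integral_comp_add_right (fun r => ‖U r‖ ^ 2),
      ← intervalIntegral.integral_add_adjacent_intervals (hi (s + h) t) (hi t (t + h)),
      ← intervalIntegral.integral_add_adjacent_intervals (hi s (s + h)) (hi (s + h) t)]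
    ring
  have hR : Tendsto (fun h : ℝ => ∫ θ in (0 : ℝ)..1, P (h * θ, h)) (𝓝[>] 0)
      (𝓝 (2 * ∫ r in s..t, (G r (W r)).re)) := by
    have hc : Continuous fun h : ℝ => ∫ θ in (0 : ℝ)..1, P (h * θ, h) :=
      intervalIntegral.continuous_parametric_intervalIntegral_of_continuous'
        (f := fun h θ => P (h * θ, h)) (by fun_prop) 0 1
    have h0 := (hc.tendsto 0).mono_left (nhdsWithin_le_nhds (s := Ioi 0))
    simp only [zero_mul, intervalIntegral.integral_const, sub_zero, one_smul] at h0
    have e : P (0, 0) = 2 * ∫ r in s..t, (G r (W r)).re := by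
      rw [intervalIntegral.integral_of_le hst, ← integral_const_mul]
      simp only [hPdef, add_zero, map_add, Complex.add_re, two_mul]
    rwa [e] at h0
  refine tendsto_nhds_unique hL (hR.congr' ?_)
  filter_upwards [Ioo_mem_nhdsGT (sub_pos.2 ht)] with h hh
  obtain ⟨hh0, hhT⟩ := hh
  -- Joint integrability for Fubini: the pairing is dominated by `‖G‖²` along the shear plus `‖W(r +
  -- h) + W r‖²`, which does not depend on `θ`.
  have hF : Integrable (Function.uncurry fun r θ => (G (r + h * θ) (W (r + h) + W r)).re)
      ((volume.restrict (Ioc s t)).prod (volume.restrict (Ioc (0 : ℝ) 1))) := by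
    have hWs : MemLp (fun r => W (r + h) + W r) 2 volume := (memLp_translate hW h).add hW
    refine Integrable.mono' ((integrable_comp_shear (hG.integrable_norm_pow two_ne_zero)
      (hGm.norm.pow 2) h (Ioc s t)).add
      (((hWs.integrable_norm_pow two_ne_zero).integrableOn (s := Ioc s t)).comp_fst _)) ?_ ?_
    · refine (stronglyMeasurable_re_apply (hGm.comp_measurable (by fun_prop)) ?_).aestronglyMeasurable
      exact (hWm.comp_measurable (g := fun p : ℝ × ℝ => p.1 + h) (by fun_prop)).add
        (hWm.comp_measurable measurable_fst)
    · exact ae_of_all _ fun p => abs_rePairing_le _ _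
  have hswap : ∫ θ in (0 : ℝ)..1, P (h * θ, h)
      = ∫ r in Ioc s t, ∫ θ in Ioc (0 : ℝ) 1, (G (r + h * θ) (W (r + h) + W r)).re := by
    rw [intervalIntegral.integral_of_le zero_le_one, integral_integral_swap hF]
  rw [hswap, intervalIntegral.integral_of_le hst, ← integral_const_mul]
  refine setIntegral_congr_ae measurableSet_Ioc ?_
  have hUW' : ∀ᵐ r, r + h ∈ Ioo 0 T → U (r + h) = J (W (r + h)) :=
    (measurePreserving_add_right volume h).quasiMeasurePreserving.ae hUW
  filter_upwards [hUW, hUW'] with r h1 h2 hr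
  have hr0 : 0 < r := hs.trans hr.1
  -- For a.e. `r` the sum `U (r + h) + U r` comes from `W (r + h) + W r` in `V`. With `r` and `h`
  -- fixed this is a constant test vector, so `hint` applies.
  have e1 : inner ℂ (U (r + h) + U r) (U (r + h) - U r)
      = ∫ ρ in r..r + h, G ρ (W (r + h) + W r) := by
    rw [← hint _ r (r + h) hr0 (by linarith) (by linarith [hr.2]), ← inner_sub_right, hJ,
      h1 ⟨hr0, by linarith [hr.2]⟩, h2 ⟨by linarith, by linarith [hr.2]⟩]
  have e2 : ‖U (r + h)‖ ^ 2 - ‖U r‖ ^ 2 = (inner ℂ (U (r + h) + U r) (U (r + h) - U r)).re := by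
    have : (inner ℂ (U r) (U (r + h))).re = (inner ℂ (U (r + h)) (U r)).re :=
      inner_re_symm (𝕜 := ℂ) _ _
    have hself : ∀ x : H, (inner ℂ x x).re = ‖x‖ ^ 2 := inner_self_eq_norm_sq (𝕜 := ℂ)
    simp only [inner_add_left, inner_sub_right, Complex.add_re, Complex.sub_re, this, hself]
    ring
  have hGi : IntegrableOn (fun ρ => G ρ (W (r + h) + W r)) (Ioc r (r + h)) := by
    have hi : IntegrableOn G (Ioc r (r + h)) :=
      (hG.restrict _).integrable one_le_two
    have := hi.norm.mul_const ‖W (r + h) + W r‖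
    refine this.mono' ?_ (ae_of_all _ fun ρ => (G ρ).le_opNorm _)
    have hc : Continuous fun g : V →L⋆[ℂ] ℂ => g (W (r + h) + W r) := by fun_prop
    exact hc.comp_aestronglyMeasurable hi.aestronglyMeasurable
  have e3 : (∫ ρ in r..r + h, G ρ (W (r + h) + W r)).re
      = ∫ ρ in r..r + h, (G ρ (W (r + h) + W r)).re := by
    rw [intervalIntegral.integral_of_le (by linarith), intervalIntegral.integral_of_le (by linarith)]
    exact (integral_re (𝕜 := ℂ) hGi).symm
  rw [e2, e1, e3, ← intervalIntegral.integral_of_le zero_le_one]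
  -- The substitution `ρ = r + h θ` produces exactly the factor `h⁻¹` of the difference quotient.
  have e4 := intervalIntegral.integral_comp_add_mul
    (fun ρ => (G ρ (W (r + h) + W r)).re) hh0.ne' r (a := 0) (b := 1)
  rw [e4]
  simp

/-- The energy identity of Lions on `[0, T]`. -/
theorem energy_identity {J : V → H} (hJ : ∀ v w, J (v + w) = J v + J w) {T : ℝ} (hT : 0 < T)
    {G : ℝ → V →L⋆[ℂ] ℂ} {W : ℝ → V}
    {U : ℝ → H} (hG : MemLp G 2 volume) (hW : MemLp W 2 volume) (hGm : StronglyMeasurable G)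
    (hWm : StronglyMeasurable W) (hU : Continuous U)
    (hUW : ∀ᵐ r, r ∈ Ioo 0 T → U r = J (W r))
    (hint : ∀ φ s t, 0 < s → s ≤ t → t < T →
      inner ℂ (J φ) (U t) - inner ℂ (J φ) (U s) = ∫ r in s..t, G r φ)
    {t : ℝ} (ht : t ∈ Icc 0 T) :
    ‖U t‖ ^ 2 - ‖U 0‖ ^ 2 = 2 * ∫ r in (0 : ℝ)..t, (G r (W r)).re := by
  have hi : Integrable fun r => (G r (W r)).re := integrable_re_apply hG hW
  -- `Φ` is constant on `(0, T)` by the interior identity and continuous, hence constant up to the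
  -- endpoints.
  set Φ : ℝ → ℝ := fun t => ‖U t‖ ^ 2 - 2 * ∫ r in (0 : ℝ)..t, (G r (W r)).re with hΦ
  have hc : Continuous Φ := by
    have := intervalIntegral.continuous_primitive (fun a b => hi.intervalIntegrable) 0
    fun_prop
  have hconst : EqOn Φ (fun _ => Φ (T / 2)) (Ioo 0 T) := by
    have key : ∀ x y, 0 < x → x ≤ y → y < T → Φ x = Φ y := by
      intro x y hx hxy hy
      have h1 := energy_identity_Ioo hJ hG hW hGm hWm hU hUW hint hx hxy hy
      have h2 := intervalIntegral.integral_add_adjacent_intervals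
        (hi.intervalIntegrable (a := 0) (b := x)) (hi.intervalIntegrable (a := x) (b := y))
      simp only [hΦ]
      rw [← h2]
      linarith
    intro x hx
    rcases le_total x (T / 2) with h | h
    · exact key x _ hx.1 h (by linarith)
    · exact (key _ x (by linarith) h hx.2).symm
  have hcl : EqOn Φ (fun _ => Φ (T / 2)) (Icc 0 T) := by
    have := hconst.closure hc continuous_const
    rwa [closure_Ioo hT.ne] at this
  have h1 := (hcl ht).trans (hcl (left_mem_Icc.2 hT.le)).symm
  simp only [hΦ, intervalIntegral.integral_same, mul_zero, sub_zero] at h1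
  linarith

theorem integrable_apply {α : Type*} [MeasurableSpace α] {μ : Measure α} [IsFiniteMeasure μ]
    (g : Lp (V →L⋆[ℂ] ℂ) 2 μ) (φ : V) : Integrable (fun t => g t φ) μ := by
  have hi : Integrable g μ := (Lp.memLp g).integrable one_le_two
  refine (hi.norm.mul_const ‖φ‖).mono' ?_ (ae_of_all _ fun t => (g t).le_opNorm _)
  have hc : Continuous fun G : V →L⋆[ℂ] ℂ => G φ := by fun_prop
  exact hc.comp_aestronglyMeasurable hi.aestronglyMeasurable

/-- The energy identity for the difference of two elements of `L²(0, T; V)` with time derivatives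
in `L²(0, T; V')`. -/
theorem energy_identity_sub {J : V → H} (hJ : ∀ v w, J (v + w) = J v + J w) {T : ℝ} (hT : 0 < T)
    {u u' : Lp V 2 (timeMeasure T)} {g g' : Lp (V →L⋆[ℂ] ℂ) 2 (timeMeasure T)} {U U' : ℝ → H}
    (hUc : Continuous U) (hUc' : Continuous U')
    (hU : ∀ᵐ r, r ∈ Ioo 0 T → U r = J (u r)) (hU' : ∀ᵐ r, r ∈ Ioo 0 T → U' r = J (u' r))
    (hint : ∀ φ s t, 0 < s → s ≤ t → t < T →
      inner ℂ (J φ) (U t) - inner ℂ (J φ) (U s) = ∫ r in s..t, g r φ)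
    (hint' : ∀ φ s t, 0 < s → s ≤ t → t < T →
      inner ℂ (J φ) (U' t) - inner ℂ (J φ) (U' s) = ∫ r in s..t, g' r φ)
    {t : ℝ} (ht : t ∈ Icc 0 T) :
    ‖U' t - U t‖ ^ 2 - ‖U' 0 - U 0‖ ^ 2
      = 2 * ∫ r in (0 : ℝ)..t, (Ioo 0 T).indicator
          (fun r => ((g' r - g r) (u' r - u r)).re) r := by
  -- Extension by zero to `ℝ` makes translations act on all of `L²(ℝ)`; only values in `(0, T)`
  -- enter the increments.
  set W : ℝ → V := (Ioo 0 T).indicator fun r => u' r - u r with hWdef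
  set G : ℝ → V →L⋆[ℂ] ℂ := (Ioo 0 T).indicator fun r => g' r - g r with hGdef
  have hW : MemLp W 2 volume :=
    (memLp_indicator_iff_restrict measurableSet_Ioo).2 ((Lp.memLp u').sub (Lp.memLp u))
  have hG : MemLp G 2 volume :=
    (memLp_indicator_iff_restrict measurableSet_Ioo).2 ((Lp.memLp g').sub (Lp.memLp g))
  have hWm : StronglyMeasurable W :=
    ((Lp.stronglyMeasurable u').sub (Lp.stronglyMeasurable u)).indicator measurableSet_Ioo
  have hGm : StronglyMeasurable G :=
    ((Lp.stronglyMeasurable g').sub (Lp.stronglyMeasurable g)).indicator measurableSet_Ioo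
  have hJsub : ∀ v w, J (v - w) = J v - J w := fun v w => by
    rw [eq_sub_iff_add_eq, ← hJ, sub_add_cancel]
  rw [energy_identity (U := fun t => U' t - U t) hJ hT hG hW hGm hWm (hUc'.sub hUc) ?_ ?_ ht]
  · congr 2
    ext r
    by_cases hr : r ∈ Ioo 0 T
    · simp only [hWdef, hGdef, indicator_of_mem hr]
    · simp only [hWdef, hGdef, indicator_of_notMem hr, map_zero, Complex.zero_re]
  · filter_upwards [hU, hU'] with r h1 h2 hr
    rw [h1 hr, h2 hr, hWdef, indicator_of_mem hr, hJsub]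
  · intro φ s t hs hst ht
    have hsub : Ioc s t ⊆ Ioo 0 T := fun r hr => ⟨hs.trans hr.1, hr.2.trans_lt ht⟩
    have hi : ∀ k : Lp (V →L⋆[ℂ] ℂ) 2 (timeMeasure T),
        IntervalIntegrable (fun r => k r φ) volume s t := fun k =>
      (intervalIntegrable_iff_integrableOn_Ioc_of_le hst).2
        (IntegrableOn.mono_set (integrable_apply k φ) hsub)
    have e : ∫ r in s..t, G r φ = (∫ r in s..t, g' r φ) - ∫ r in s..t, g r φ := by
      rw [← intervalIntegral.integral_sub (hi g') (hi g)]
      refine intervalIntegral.integral_congr_ae (ae_of_all _ fun r hr => ?_)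
      rw [uIoc_of_le hst] at hr
      rw [hGdef, indicator_of_mem (hsub hr), sub_apply]
    rw [e, ← hint φ s t hs hst ht, ← hint' φ s t hs hst ht]
    simp only [inner_sub_right]
    ring

theorem integrable_indicator_re_sub_apply {T : ℝ} (u u' : Lp V 2 (timeMeasure T))
    (g g' : Lp (V →L⋆[ℂ] ℂ) 2 (timeMeasure T)) :
    Integrable ((Ioo 0 T).indicator fun r => ((g' r - g r) (u' r - u r)).re) :=
  (integrable_indicator_iff measurableSet_Ioo).2
    (integrable_re_apply ((Lp.memLp g').sub (Lp.memLp g)) ((Lp.memLp u').sub (Lp.memLp u)))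

end Energy

/-! ### `H¹` and the fractional Laplacian -/

theorem norm_sq_eq_integral {α E : Type*} [MeasurableSpace α] {μ : Measure α}
    [NormedAddCommGroup E] [InnerProductSpace ℂ E] (f : Lp E 2 μ) :
    ‖f‖ ^ 2 = ∫ x, ‖f x‖ ^ 2 ∂μ := by
  have h1 : ((‖f‖ ^ 2 : ℝ) : ℂ) = ((∫ x, ‖f x‖ ^ 2 ∂μ : ℝ) : ℂ) := by
    have h2 := inner_self_eq_norm_sq_to_K (𝕜 := ℂ) f
    rw [L2.inner_def] at h2
    rw [← integral_complex_ofReal, Complex.ofReal_pow]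
    refine h2.symm.trans (integral_congr_ae (ae_of_all _ fun x => ?_))
    simp only [inner_self_eq_norm_sq_to_K, Complex.ofReal_pow]
    rfl
  exact_mod_cast h1

theorem integrable_norm_sq {α E : Type*} [MeasurableSpace α] {μ : Measure α}
    [NormedAddCommGroup E] (f : Lp E 2 μ) : Integrable (fun x => ‖f x‖ ^ 2) μ :=
  (Lp.memLp f).integrable_norm_pow two_ne_zero

variable {d : ℕ} {T : ℝ}

theorem H1.norm_sq (u : H1 d) : ‖u‖ ^ 2 = ‖u.toL2‖ ^ 2 + ∑ i, ‖u.partialDeriv i‖ ^ 2 := by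
  rw [Submodule.coe_norm, WithLp.prod_norm_sq_eq_of_L2, PiLp.norm_sq_eq_of_L2]
  rfl

theorem H1.norm_toL2_le (u : H1 d) : ‖u.toL2‖ ≤ ‖u‖ := by
  refine le_of_sq_le_sq ?_ (norm_nonneg _)
  rw [u.norm_sq]
  exact le_add_of_nonneg_right (Finset.sum_nonneg fun i _ => sq_nonneg _)

theorem H1.norm_partialDeriv_le (u : H1 d) (i : Fin d) : ‖u.partialDeriv i‖ ≤ ‖u‖ := by
  refine le_of_sq_le_sq ?_ (norm_nonneg _)
  rw [u.norm_sq]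
  exact (Finset.single_le_sum (f := fun i => ‖u.partialDeriv i‖ ^ 2)
    (fun i _ => sq_nonneg _) (Finset.mem_univ i)).trans (le_add_of_nonneg_left (sq_nonneg _))

@[simp]
theorem H1.toL2_add (u v : H1 d) : (u + v).toL2 = u.toL2 + v.toL2 := rfl

@[simp]
theorem H1.toL2_sub (u v : H1 d) : (u - v).toL2 = u.toL2 - v.toL2 := rfl

@[simp]
theorem H1.partialDeriv_add (u v : H1 d) (i : Fin d) :
    (u + v).partialDeriv i = u.partialDeriv i + v.partialDeriv i := rfl

theorem rpow_sq_le {r σ : ℝ} (hr : 0 ≤ r) (h0 : 0 ≤ σ) (h1 : σ ≤ 1 / 2) :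
    (r ^ (2 * σ)) ^ 2 ≤ 1 + r ^ 2 := by
  rcases le_total r 1 with h | h
  · have h2 := Real.rpow_le_one hr h (by linarith : 0 ≤ 2 * σ)
    have h3 := Real.rpow_nonneg hr (2 * σ)
    nlinarith [sq_nonneg r]
  · have h2 := Real.rpow_le_rpow_of_exponent_le h (by linarith : 2 * σ ≤ 1)
    rw [Real.rpow_one] at h2
    have h3 := Real.rpow_nonneg hr (2 * σ)
    nlinarith

/-- Summed over `i`, the squares of the transformed derivatives give `(2π|ξ|)² |û|²`, so this is
`rpow_sq_le` at `r = 2π|ξ|`. -/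
theorem norm_fracSymbolMul_sq_le {σ : ℝ} (h0 : 0 ≤ σ) (h1 : σ ≤ 1 / 2) (u : H1 d) :
    ∀ᵐ ξ, ‖fracSymbolMul σ u.toL2 ξ‖ ^ 2 ≤ ‖(𝓕 u.toL2 : L2 d) ξ‖ ^ 2
      + ∑ i, ‖(𝓕 (u.partialDeriv i) : L2 d) ξ‖ ^ 2 := by
  filter_upwards [ae_all_iff.2 fun i => fourier_partialDeriv_ae u i] with ξ hξ
  have hr : 0 ≤ 2 * Real.pi * ‖ξ‖ := by positivity
  have hpi : ∀ i, ‖(𝓕 (u.partialDeriv i) : L2 d) ξ‖ ^ 2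
      = (2 * Real.pi) ^ 2 * ‖ξ i‖ ^ 2 * ‖(𝓕 u.toL2 : L2 d) ξ‖ ^ 2 := by
    intro i
    rw [hξ i, ← mul_pow, ← mul_pow]
    simp [abs_of_pos Real.pi_pos]
  rw [fracSymbolMul, norm_mul, Complex.norm_real, Real.norm_of_nonneg (Real.rpow_nonneg hr _),
    mul_pow]
  simp only [hpi]
  rw [← Finset.sum_mul, ← Finset.mul_sum, ← EuclideanSpace.norm_sq_eq, ← mul_pow]
  have h2 := mul_le_mul_of_nonneg_right (rpow_sq_le hr h0 h1)
    (sq_nonneg ‖(𝓕 u.toL2 : L2 d) ξ‖)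
  linarith

theorem fracLaplacian_eq {σ : ℝ} (h0 : 0 ≤ σ) (h1 : σ ≤ 1 / 2) (u : H1 d) :
    fracLaplacian σ u.toL2 = 𝓕⁻ ((memLp_fracSymbolMul h0 h1 u).toLp (fracSymbolMul σ u.toL2)) :=
  dif_pos _

/-- Plancherel carries the pointwise bound on the frequency side back to `L²`, with constant `1`. -/
theorem norm_fracLaplacian_le {σ : ℝ} (h0 : 0 ≤ σ) (h1 : σ ≤ 1 / 2) (u : H1 d) :
    ‖fracLaplacian σ u.toL2‖ ≤ ‖u‖ := by
  refine le_of_sq_le_sq ?_ (norm_nonneg _)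
  rw [fracLaplacian_eq h0 h1, ← Lp.norm_fourier_eq (𝓕⁻ _), FourierTransform.fourier_fourierInv_eq,
    norm_sq_eq_integral, u.norm_sq, ← Lp.norm_fourier_eq u.toL2, norm_sq_eq_integral]
  have e : ∀ i, ‖u.partialDeriv i‖ ^ 2 = ∫ ξ, ‖(𝓕 (u.partialDeriv i) : L2 d) ξ‖ ^ 2 := by
    intro i
    rw [← norm_sq_eq_integral, Lp.norm_fourier_eq]
  simp only [e]
  rw [← integral_finsetSum _ fun i _ => integrable_norm_sq _,
    ← integral_add (integrable_norm_sq _) (integrable_finsetSum _ fun i _ => integrable_norm_sq _)]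
  refine integral_mono_ae (integrable_norm_sq _) ((integrable_norm_sq _).add
    (integrable_finsetSum _ fun i _ => integrable_norm_sq _)) ?_
  filter_upwards [norm_fracSymbolMul_sq_le h0 h1 u,
    (memLp_fracSymbolMul h0 h1 u).coeFn_toLp] with ξ h2 h3
  simpa only [h3] using h2

/-- On `H¹` the default value `0` never intervenes, so linearity of the multiplier and of the
Fourier transform is available. -/
theorem fracLaplacian_add {σ : ℝ} (h0 : 0 ≤ σ) (h1 : σ ≤ 1 / 2) (u v : H1 d) :
    fracLaplacian σ (u + v).toL2 = fracLaplacian σ u.toL2 + fracLaplacian σ v.toL2 := by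
  rw [fracLaplacian_eq h0 h1, fracLaplacian_eq h0 h1, fracLaplacian_eq h0 h1,
    ← FourierTransform.fourierInv_add, ← MemLp.toLp_add]
  congr 1
  refine MemLp.toLp_congr _ _ ?_
  have h2 : (𝓕 (u + v).toL2 : L2 d) = 𝓕 u.toL2 + 𝓕 v.toL2 := FourierTransform.fourier_add _ _
  filter_upwards [Lp.coeFn_add (𝓕 u.toL2 : L2 d) (𝓕 v.toL2)] with ξ h3
  rw [Pi.add_apply, fracSymbolMul, h2, h3, Pi.add_apply, mul_add]
  rfl

/-! ### The energy form: boundedness and coercivity -/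

/-- The bounded sesquilinear form `∫ a f conj g` on `L²`. -/
def weightedInner (a : Linf d) (f g : L2 d) : ℂ := inner ℂ g (a • f : L2 d)

theorem weightedInner_ae (a : Linf d) (f g : L2 d) :
    ∀ᵐ x, inner ℂ (g x) ((a • f : L2 d) x) = (a x : ℂ) * (f x * conj (g x)) := by
  filter_upwards [Lp.coeFn_lpSMul (r := 2) a f] with x hx
  rw [hx, Pi.smul_apply', Complex.real_smul, RCLike.inner_apply, mul_assoc]

theorem weightedInner_eq_integral (a : Linf d) (f g : L2 d) :
    weightedInner a f g = ∫ x, (a x : ℂ) * (f x * conj (g x)) := by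
  rw [weightedInner, L2.inner_def]
  exact integral_congr_ae (weightedInner_ae a f g)

theorem integrable_weightedInner (a : Linf d) (f g : L2 d) :
    Integrable fun x => (a x : ℂ) * (f x * conj (g x)) :=
  (L2.integrable_inner (𝕜 := ℂ) g (a • f : L2 d)).congr (weightedInner_ae a f g)

theorem norm_weightedInner_le (a : Linf d) (f g : L2 d) :
    ‖weightedInner a f g‖ ≤ ‖a‖ * ‖f‖ * ‖g‖ := by
  refine (norm_inner_le_norm _ _).trans ?_
  rw [mul_comm]
  gcongr
  exact Lp.norm_smul_le a f

theorem weightedInner_add (a : Linf d) (f f' g : L2 d) :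
    weightedInner a (f + f') g = weightedInner a f g + weightedInner a f' g := by
  rw [weightedInner, Lp.add_smul, inner_add_right]
  rfl

theorem weightedInner_sub_coeff (a a' : Linf d) (f g : L2 d) :
    weightedInner (a - a') f g = weightedInner a f g - weightedInner a' f g := by
  rw [weightedInner, sub_eq_add_neg, Lp.smul_add, Lp.neg_smul, inner_add_right, inner_neg_right,
    ← sub_eq_add_neg]
  rfl

theorem le_re_weightedInner {a : Linf d} {a₀ : ℝ} (ha : ∀ᵐ x, a₀ ≤ a x) (f : L2 d) :
    a₀ * ‖f‖ ^ 2 ≤ (weightedInner a f f).re := by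
  rw [weightedInner_eq_integral, norm_sq_eq_integral, ← integral_const_mul]
  have hre := integral_re (𝕜 := ℂ) (integrable_weightedInner a f f)
  refine le_of_le_of_eq ?_ hre
  refine integral_mono_ae ((integrable_norm_sq f).const_mul _)
    (integrable_weightedInner a f f).re ?_
  filter_upwards [ha] with x hx
  have e : ((a x : ℂ) * (f x * conj (f x))).re = a x * ‖f x‖ ^ 2 := by
    rw [Complex.mul_conj, Complex.normSq_eq_norm_sq, ← Complex.ofReal_mul, Complex.ofReal_re]
  refine le_of_le_of_eq ?_ e.symm
  gcongr

theorem energyForm_eq (s : ℝ) (a b c : Linf d) (u v : H1 d) :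
    energyForm s a b c u v = ∑ i, weightedInner a (u.partialDeriv i) (v.partialDeriv i)
      + weightedInner b (fracLaplacian (s / 2) u.toL2) (fracLaplacian (s / 2) v.toL2)
      + weightedInner c u.toL2 v.toL2 := by
  simp only [weightedInner_eq_integral]
  rw [← integral_finsetSum _ fun i _ => integrable_weightedInner _ _ _]
  simp only [← Finset.mul_sum]
  rfl

theorem energyForm_sub_coeff (s : ℝ) (a b c a' b' c' : Linf d) (u v : H1 d) :
    energyForm s (a - a') (b - b') (c - c') u v
      = energyForm s a b c u v - energyForm s a' b' c' u v := by
  simp only [energyForm_eq, weightedInner_sub_coeff, Finset.sum_sub_distrib]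
  ring

theorem energyForm_add {s : ℝ} (h0 : 0 ≤ s) (h1 : s ≤ 1) (a b c : Linf d) (u u' v : H1 d) :
    energyForm s a b c (u + u') v = energyForm s a b c u v + energyForm s a b c u' v := by
  rw [energyForm_eq, fracLaplacian_add (by linarith) (by linarith)]
  simp only [energyForm_eq, H1.partialDeriv_add, H1.toL2_add, weightedInner_add,
    Finset.sum_add_distrib]
  ring

/-- Each of the `d` gradient terms is bounded separately by the full `H¹` norms; this is the source
of the factor `d`. Applied to differences of coefficients, it measures their effect on the equation.
-/
theorem norm_energyForm_le {s : ℝ} (h0 : 0 ≤ s) (h1 : s ≤ 1) (a b c : Linf d) (u v : H1 d) :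
    ‖energyForm s a b c u v‖ ≤ (d * ‖a‖ + ‖b‖ + ‖c‖) * (‖u‖ * ‖v‖) := by
  have hs0 : 0 ≤ s / 2 := by linarith
  have hs1 : s / 2 ≤ 1 / 2 := by linarith
  rw [energyForm_eq]
  have e : (d * ‖a‖ + ‖b‖ + ‖c‖) * (‖u‖ * ‖v‖)
      = (∑ _i : Fin d, ‖a‖ * ‖u‖ * ‖v‖) + ‖b‖ * ‖u‖ * ‖v‖ + ‖c‖ * ‖u‖ * ‖v‖ := by
    rw [Finset.sum_const, Finset.card_univ, Fintype.card_fin, nsmul_eq_mul]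
    ring
  rw [e]
  refine (norm_add₃_le).trans (add_le_add_three ?_ ?_ ?_)
  · refine norm_sum_le_of_le _ fun i _ => (norm_weightedInner_le _ _ _).trans ?_
    gcongr
    · exact u.norm_partialDeriv_le i
    · exact v.norm_partialDeriv_le i
  · refine (norm_weightedInner_le _ _ _).trans ?_
    gcongr
    · exact norm_fracLaplacian_le hs0 hs1 u
    · exact norm_fracLaplacian_le hs0 hs1 v
  · refine (norm_weightedInner_le _ _ _).trans ?_
    gcongr
    · exact u.norm_toL2_le
    · exact v.norm_toL2_le

/-- The gradient term and the zeroth-order term together already control the full `H¹` norm; the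
fractional term is nonnegative and is discarded. -/
theorem le_re_energyForm (s : ℝ) {a b c : Linf d} {a₀ b₀ c₀ : ℝ} (hb₀ : 0 ≤ b₀)
    (ha : ∀ᵐ x, a₀ ≤ a x) (hb : ∀ᵐ x, b₀ ≤ b x) (hc : ∀ᵐ x, c₀ ≤ c x) (u : H1 d) :
    min a₀ c₀ * ‖u‖ ^ 2 ≤ (energyForm s a b c u u).re := by
  rw [energyForm_eq, u.norm_sq, Complex.add_re, Complex.add_re, Complex.re_sum]
  have h1 : min a₀ c₀ * ∑ i, ‖u.partialDeriv i‖ ^ 2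
      ≤ ∑ i, (weightedInner a (u.partialDeriv i) (u.partialDeriv i)).re := by
    rw [Finset.mul_sum]
    refine Finset.sum_le_sum fun i _ => le_trans ?_ (le_re_weightedInner ha _)
    gcongr
    exact min_le_left _ _
  have h2 := le_re_weightedInner hb (fracLaplacian (s / 2) u.toL2)
  have h3 := le_re_weightedInner hc u.toL2
  have h4 : min a₀ c₀ * ‖u.toL2‖ ^ 2 ≤ c₀ * ‖u.toL2‖ ^ 2 := by
    gcongr
    exact min_le_right _ _
  have h5 : 0 ≤ b₀ * ‖fracLaplacian (s / 2) u.toL2‖ ^ 2 := by positivity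
  linarith

/-! ### The energy identity for continuous representatives -/

theorem continuous_iccExtend (hT : 0 < T) (U : CL2 d T) : Continuous (IccExtend hT.le U) :=
  U.continuous.Icc_extend'

theorem IsContRep.iccExtend_ae (hT : 0 < T) {u : L2H1 d T} {U : CL2 d T} (hU : IsContRep u U) :
    ∀ᵐ t, t ∈ Ioo 0 T → IccExtend hT.le U t = (u t).toL2 := by
  have h := (ae_restrict_iff' measurableSet_Ioo).1 hU
  filter_upwards [h] with t ht ht'
  rw [IccExtend_of_mem _ _ (Ioo_subset_Icc_self ht')]
  exact ht ht' _

/-- The weak time derivative integrates to the increments of the continuous representative. -/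
theorem IsWeakTimeDeriv.inner_sub_inner_eq_integral (hT : 0 < T) {u : L2H1 d T}
    {g : L2H1Dual d T} (hg : IsWeakTimeDeriv u g) {U : CL2 d T} (hU : IsContRep u U) (φ : H1 d)
    {s t : ℝ} (hs : 0 < s) (hst : s ≤ t) (ht : t < T) :
    inner ℂ φ.toL2 (IccExtend hT.le U t) - inner ℂ φ.toL2 (IccExtend hT.le U s)
      = ∫ r in s..t, g r φ := by
  have hUc := continuous_iccExtend hT U
  refine sub_eq_integral_of_forall_test (T := T)
    (f := fun t => inner ℂ φ.toL2 (IccExtend hT.le U t)) (C := ‖φ.toL2‖ * ‖U‖)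
    (by fun_prop) (fun x => ?_) (integrable_apply g φ) (fun η h1 h2 h3 => ?_) hs hst ht
  · refine (norm_inner_le_norm _ _).trans ?_
    gcongr
    exact U.norm_coe_le_norm _
  · rw [← hg η h1 h2 h3 φ]
    refine setIntegral_congr_ae measurableSet_Ioo ?_
    filter_upwards [hU.iccExtend_ae hT] with r hr hr'
    rw [hr hr']

/-- The energy identity for the difference of two functions in
`L²(0, T; H¹)` with weak time derivatives in `L²(0, T; (H¹)')`. -/
theorem IsWeakTimeDeriv.norm_sub_sq_eq (hT : 0 < T) {u u' : L2H1 d T} {g g' : L2H1Dual d T}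
    (hg : IsWeakTimeDeriv u g) (hg' : IsWeakTimeDeriv u' g') {U U' : CL2 d T}
    (hU : IsContRep u U) (hU' : IsContRep u' U') (t : Icc (0 : ℝ) T) :
    ‖U' t - U t‖ ^ 2 - ‖U' ⟨0, left_mem_Icc.2 hT.le⟩ - U ⟨0, left_mem_Icc.2 hT.le⟩‖ ^ 2
      = 2 * ∫ r in (0 : ℝ)..t, (Ioo 0 T).indicator
          (fun r => ((g' r - g r) (u' r - u r)).re) r := by
  have key := energy_identity_sub (J := H1.toL2) (fun _ _ => rfl) hT (continuous_iccExtend hT U)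
    (continuous_iccExtend hT U') (hU.iccExtend_ae hT) (hU'.iccExtend_ae hT)
    (fun φ _ _ hs hst ht => hg.inner_sub_inner_eq_integral hT hU φ hs hst ht)
    (fun φ _ _ hs hst ht => hg'.inner_sub_inner_eq_integral hT hU' φ hs hst ht) t.2
  have hz : (0 : ℝ) ∈ Icc 0 T := left_mem_Icc.2 hT.le
  rwa [IccExtend_of_mem _ _ t.2, IccExtend_of_mem _ _ t.2, IccExtend_of_mem _ _ hz,
    IccExtend_of_mem _ _ hz] at key

theorem integrable_indicator_norm_sq (u : L2H1 d T) :
    Integrable ((Ioo 0 T).indicator fun r => ‖u r‖ ^ 2) :=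
  (integrable_indicator_iff measurableSet_Ioo).2 (integrable_norm_sq u)

theorem integral_indicator_norm_sq (u : L2H1 d T) :
    ∫ r, (Ioo 0 T).indicator (fun r => ‖u r‖ ^ 2) r = ‖u‖ ^ 2 := by
  rw [integral_indicator measurableSet_Ioo, norm_sq_eq_integral]

theorem intervalIntegral_indicator_norm_sq (hT : 0 < T) (u : L2H1 d T) :
    ∫ r in (0 : ℝ)..T, (Ioo 0 T).indicator (fun r => ‖u r‖ ^ 2) r = ‖u‖ ^ 2 := by
  rw [intervalIntegral.integral_of_le hT.le, integral_Ioc_eq_integral_Ioo,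
    setIntegral_indicator measurableSet_Ioo, inter_self, norm_sq_eq_integral]

/-! ### Stability in the coefficients and the initial data -/

/-- The pointwise dissipation estimate for the difference of two solutions. -/
theorem re_apply_sub_le {s : ℝ} (hs0 : 0 ≤ s) (hs1 : s ≤ 1) {a b c a' b' c' : Linf d}
    {a₀ b₀ c₀ : ℝ} (ha₀ : 0 < a₀) (hb₀ : 0 < b₀) (hc₀ : 0 < c₀)
    (ha : ∀ᵐ x, a₀ ≤ a' x) (hb : ∀ᵐ x, b₀ ≤ b' x) (hc : ∀ᵐ x, c₀ ≤ c' x)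
    {v v' : H1 d} {g g' : H1Dual d}
    (hg : ∀ φ, g φ + energyForm s a b c v φ = 0)
    (hg' : ∀ φ, g' φ + energyForm s a' b' c' v' φ = 0) :
    2 * ((g' - g) (v' - v)).re ≤ -(min a₀ c₀ * ‖v' - v‖ ^ 2)
      + (d * ‖a' - a‖ + ‖b' - b‖ + ‖c' - c‖) ^ 2 / min a₀ c₀ * ‖v‖ ^ 2 := by
  set m := min a₀ c₀ with hm
  have hm0 : 0 < m := lt_min ha₀ hc₀
  set δ := d * ‖a' - a‖ + ‖b' - b‖ + ‖c' - c‖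
  set w := v' - v with hw
  have e1 : energyForm s a' b' c' v' w
      = energyForm s a' b' c' v w + energyForm s a' b' c' w w := by
    rw [← energyForm_add hs0 hs1, hw, add_sub_cancel]
  -- The perturbed form acts on `w`, where its coercivity is used, and the coefficient difference
  -- acts on `v`, whose norm stays fixed in the limit.
  have e2 : (g' - g) w = -energyForm s a' b' c' w w
      - energyForm s (a' - a) (b' - b) (c' - c) v w := by
    rw [energyForm_sub_coeff, sub_apply]
    linear_combination hg' w - hg w - e1
  have h1 := le_re_energyForm s hb₀.le ha hb hc w
  have h2 : -(energyForm s (a' - a) (b' - b) (c' - c) v w).re ≤ δ * (‖v‖ * ‖w‖) :=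
    (neg_le_abs _).trans ((Complex.abs_re_le_norm _).trans (norm_energyForm_le hs0 hs1 _ _ _ _ _))
  -- Young's inequality with weight `m`: one half of the dissipation `2 m ‖w‖²` absorbs the error
  -- term, the other half remains.
  have h3 : 2 * (δ * (‖v‖ * ‖w‖)) ≤ m * ‖w‖ ^ 2 + δ ^ 2 / m * ‖v‖ ^ 2 := by
    have : m * ‖w‖ ^ 2 + δ ^ 2 / m * ‖v‖ ^ 2 - 2 * (δ * (‖v‖ * ‖w‖))
        = (m * ‖w‖ - δ * ‖v‖) ^ 2 / m := by
      field_simp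
      ring
    linarith [div_nonneg (sq_nonneg (m * ‖w‖ - δ * ‖v‖)) hm0.le]
  rw [e2, Complex.sub_re, Complex.neg_re]
  linarith

/-- Stability of weak solutions with respect to coefficients and initial data. -/
theorem stability_estimate (hT : 0 < T) {s : ℝ} (hs0 : 0 ≤ s) (hs1 : s ≤ 1)
    {a b c a' b' c' : Linf d} {a₀ b₀ c₀ : ℝ} (ha₀ : 0 < a₀) (hb₀ : 0 < b₀) (hc₀ : 0 < c₀)
    (ha : ∀ᵐ x, a₀ ≤ a' x) (hb : ∀ᵐ x, b₀ ≤ b' x) (hc : ∀ᵐ x, c₀ ≤ c' x)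
    {u₀ u₀' : H1 d} {u u' : L2H1 d T}
    (hu : IsWeakSolution hT s a b c u₀ u) (hu' : IsWeakSolution hT s a' b' c' u₀' u')
    {U U' : CL2 d T} (hU : IsContRep u U) (hU' : IsContRep u' U')
    (hU0 : U ⟨0, left_mem_Icc.2 hT.le⟩ = u₀.toL2)
    (hU0' : U' ⟨0, left_mem_Icc.2 hT.le⟩ = u₀'.toL2) (t : Icc (0 : ℝ) T) :
    ‖U' t - U t‖ ^ 2 + min a₀ c₀ *
        ∫ r in (0 : ℝ)..t, (Ioo 0 T).indicator (fun r => ‖(u' - u) r‖ ^ 2) r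
      ≤ ‖u₀' - u₀‖ ^ 2
        + (d * ‖a' - a‖ + ‖b' - b‖ + ‖c' - c‖) ^ 2 / min a₀ c₀ * ‖u‖ ^ 2 := by
  obtain ⟨g, hg, heq⟩ := hu.equation
  obtain ⟨g', hg', heq'⟩ := hu'.equation
  have hE := hg.norm_sub_sq_eq hT hg' hU hU' t
  rw [hU0, hU0', ← H1.toL2_sub] at hE
  -- The energy identity sees the initial data only in `L²`; the `H¹` distance is a convenient upper
  -- bound.
  have h0 : ‖(u₀' - u₀).toL2‖ ^ 2 ≤ ‖u₀' - u₀‖ ^ 2 := by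
    gcongr
    exact (u₀' - u₀).norm_toL2_le
  set m := min a₀ c₀ with hm
  have hm0 : 0 < m := lt_min ha₀ hc₀
  set δ := d * ‖a' - a‖ + ‖b' - b‖ + ‖c' - c‖
  set p := (Ioo 0 T).indicator fun r => ‖(u' - u) r‖ ^ 2 with hp
  set q := (Ioo 0 T).indicator fun r => ‖u r‖ ^ 2 with hq
  have hpi : Integrable p := integrable_indicator_norm_sq _
  have hqi : Integrable q := integrable_indicator_norm_sq _
  have hRi := integrable_indicator_re_sub_apply u u' g g'
  have hmp : Integrable fun r => -(m * p r) := (hpi.const_mul m).neg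
  have hmq : Integrable fun r => δ ^ 2 / m * q r := hqi.const_mul _
  have hle : 2 * ∫ r in (0 : ℝ)..t, (Ioo 0 T).indicator
        (fun r => ((g' r - g r) (u' r - u r)).re) r
      ≤ ∫ r in (0 : ℝ)..t, (-(m * p r) + δ ^ 2 / m * q r) := by
    rw [← intervalIntegral.integral_const_mul]
    refine intervalIntegral.integral_mono_ae t.2.1 (hRi.const_mul 2).intervalIntegrable
      (hmp.add hmq).intervalIntegrable ?_
    filter_upwards [(ae_restrict_iff' measurableSet_Ioo).1 heq,
      (ae_restrict_iff' measurableSet_Ioo).1 heq',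
      (ae_restrict_iff' measurableSet_Ioo).1 (Lp.coeFn_sub u' u)] with r h1 h2 h3
    by_cases hr : r ∈ Ioo 0 T
    · simp only [hp, hq, indicator_of_mem hr]
      rw [h3 hr]
      exact re_apply_sub_le hs0 hs1 ha₀ hb₀ hc₀ ha hb hc (h1 hr) (h2 hr)
    · simp [hp, hq, indicator_of_notMem hr]
  rw [intervalIntegral.integral_add hmp.intervalIntegrable hmq.intervalIntegrable,
    intervalIntegral.integral_neg, intervalIntegral.integral_const_mul,
    intervalIntegral.integral_const_mul] at hle
  have hqle : ∫ r in (0 : ℝ)..t, q r ≤ ‖u‖ ^ 2 := by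
    rw [← integral_indicator_norm_sq u, intervalIntegral.integral_of_le t.2.1]
    exact setIntegral_le_integral hqi
      (ae_of_all _ fun r => indicator_nonneg (fun _ _ => sq_nonneg _) r)
  have hq' : δ ^ 2 / m * ∫ r in (0 : ℝ)..t, q r ≤ δ ^ 2 / m * ‖u‖ ^ 2 := by gcongr
  linarith

/-- Both terms on the left of the stability estimate are nonnegative. Dropping the integral at every
`t` gives the supremum bound; dropping the pointwise term at `t = T` gives the `L²(0, T; H¹)` bound.
-/
theorem norm_sub_sq_le (hT : 0 < T) {s : ℝ} (hs0 : 0 ≤ s) (hs1 : s ≤ 1)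
    {a b c a' b' c' : Linf d} {a₀ b₀ c₀ : ℝ} (ha₀ : 0 < a₀) (hb₀ : 0 < b₀) (hc₀ : 0 < c₀)
    (ha : ∀ᵐ x, a₀ ≤ a' x) (hb : ∀ᵐ x, b₀ ≤ b' x) (hc : ∀ᵐ x, c₀ ≤ c' x)
    {u₀ u₀' : H1 d} {u u' : L2H1 d T}
    (hu : IsWeakSolution hT s a b c u₀ u) (hu' : IsWeakSolution hT s a' b' c' u₀' u')
    {U U' : CL2 d T} (hU : IsContRep u U) (hU' : IsContRep u' U')
    (hU0 : U ⟨0, left_mem_Icc.2 hT.le⟩ = u₀.toL2)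
    (hU0' : U' ⟨0, left_mem_Icc.2 hT.le⟩ = u₀'.toL2) :
    ‖U' - U‖ ≤ √(‖u₀' - u₀‖ ^ 2
        + (d * ‖a' - a‖ + ‖b' - b‖ + ‖c' - c‖) ^ 2 / min a₀ c₀ * ‖u‖ ^ 2) ∧
      ‖u' - u‖ ≤ √((‖u₀' - u₀‖ ^ 2
        + (d * ‖a' - a‖ + ‖b' - b‖ + ‖c' - c‖) ^ 2 / min a₀ c₀ * ‖u‖ ^ 2) / min a₀ c₀) := by
  have hm0 : 0 < min a₀ c₀ := lt_min ha₀ hc₀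
  have key := stability_estimate hT hs0 hs1 ha₀ hb₀ hc₀ ha hb hc hu hu' hU hU' hU0 hU0'
  constructor
  · rw [ContinuousMap.norm_le _ (Real.sqrt_nonneg _)]
    intro t
    refine Real.le_sqrt_of_sq_le (le_trans ?_ (key t))
    refine le_add_of_nonneg_right (mul_nonneg hm0.le ?_)
    exact intervalIntegral.integral_nonneg t.2.1
      fun r _ => indicator_nonneg (fun _ _ => sq_nonneg _) r
  · refine Real.le_sqrt_of_sq_le ?_
    rw [le_div_iff₀' hm0]
    have := key ⟨T, right_mem_Icc.2 hT.le⟩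
    rw [intervalIntegral_indicator_norm_sq hT] at this
    exact (le_add_of_nonneg_left (sq_nonneg _)).trans this

end MixedHeat

end

/-! ### Passage to the limit -/

theorem mainTheorem4 {d : ℕ} {T : ℝ} (hT : 0 < T) {s : ℝ} (hs0 : 0 < s) (hs1 : s < 1)
    {a₀ b₀ c₀ : ℝ} (ha₀ : 0 < a₀) (hb₀ : 0 < b₀) (hc₀ : 0 < c₀)
    (a b c : MixedHeat.Linf d)
    (ha : ∀ᵐ x, a₀ ≤ a x) (hb : ∀ᵐ x, b₀ ≤ b x) (hc : ∀ᵐ x, c₀ ≤ c x)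
    (u₀ : MixedHeat.H1 d) (u : MixedHeat.L2H1 d T)
    (hu : MixedHeat.IsWeakSolution hT s a b c u₀ u)
    (aε bε cε : ℝ → MixedHeat.Linf d) (u₀ε : ℝ → MixedHeat.H1 d)
    (haε : Tendsto aε (𝓝[>] 0) (𝓝 a)) (hbε : Tendsto bε (𝓝[>] 0) (𝓝 b))
    (hcε : Tendsto cε (𝓝[>] 0) (𝓝 c)) (hu₀ε : Tendsto u₀ε (𝓝[>] 0) (𝓝 u₀))
    (hpos : ∀ ε ∈ Ioc (0 : ℝ) 1,
      (∀ᵐ x, a₀ ≤ aε ε x) ∧ (∀ᵐ x, b₀ ≤ bε ε x) ∧ (∀ᵐ x, c₀ ≤ cε ε x))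
    (uε : ℝ → MixedHeat.L2H1 d T)
    (huε : ∀ ε ∈ Ioc (0 : ℝ) 1,
      MixedHeat.IsWeakSolution hT s (aε ε) (bε ε) (cε ε) (u₀ε ε) (uε ε)) :
    (∃ (U : MixedHeat.CL2 d T) (Uε : ℝ → MixedHeat.CL2 d T),
      MixedHeat.IsContRep u U ∧ (∀ ε ∈ Ioc (0 : ℝ) 1, MixedHeat.IsContRep (uε ε) (Uε ε)) ∧
      Tendsto Uε (𝓝[>] 0) (𝓝 U)) ∧
    Tendsto uε (𝓝[>] 0) (𝓝 u) := by
  obtain ⟨U, hU, hU0⟩ := hu.initial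
  -- Outside `(0, 1]` the chosen functions are arbitrary; the limit ignores them because `(0, 1]`
  -- belongs to `𝓝[>] 0`.
  choose! Uε hUε hUε0 using fun ε hε => (huε ε hε).initial
  set K : ℝ → ℝ := fun ε => ‖u₀ε ε - u₀‖ ^ 2
    + (d * ‖aε ε - a‖ + ‖bε ε - b‖ + ‖cε ε - c‖) ^ 2 / min a₀ c₀ * ‖u‖ ^ 2 with hK
  have hK0 : Tendsto K (𝓝[>] 0) (𝓝 0) := by
    have h1 := (tendsto_iff_norm_sub_tendsto_zero.1 hu₀ε).pow 2
    have h2 := ((((tendsto_iff_norm_sub_tendsto_zero.1 haε).const_mul (d : ℝ)).add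
      (tendsto_iff_norm_sub_tendsto_zero.1 hbε)).add
      (tendsto_iff_norm_sub_tendsto_zero.1 hcε)).pow 2
    have h3 : Tendsto K (𝓝[>] 0)
        (𝓝 (0 ^ 2 + (d * 0 + 0 + 0) ^ 2 / min a₀ c₀ * ‖u‖ ^ 2)) :=
      h1.add ((h2.div_const (min a₀ c₀)).mul_const (‖u‖ ^ 2))
    simpa using h3
  have hK1 : Tendsto (fun ε => √(K ε)) (𝓝[>] 0) (𝓝 0) := by
    simpa [Function.comp_def] using (Real.continuous_sqrt.tendsto 0).comp hK0
  have hK2 : Tendsto (fun ε => √(K ε / min a₀ c₀)) (𝓝[>] 0) (𝓝 0) := by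
    have h1 : Tendsto (fun ε => K ε / min a₀ c₀) (𝓝[>] 0) (𝓝 0) := by
      simpa using hK0.div_const (min a₀ c₀)
    simpa [Function.comp_def] using (Real.continuous_sqrt.tendsto 0).comp h1
  have hmem : Ioc (0 : ℝ) 1 ∈ 𝓝[>] (0 : ℝ) := Ioc_mem_nhdsGT one_pos
  have est := fun ε hε => MixedHeat.norm_sub_sq_le hT hs0.le hs1.le ha₀ hb₀ hc₀ (hpos ε hε).1
    (hpos ε hε).2.1 (hpos ε hε).2.2 hu (huε ε hε) hU (hUε ε hε) hU0 (hUε0 ε hε)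
  refine ⟨⟨U, Uε, hU, hUε, ?_⟩, ?_⟩
  · rw [tendsto_iff_norm_sub_tendsto_zero]
    refine squeeze_zero' (Eventually.of_forall fun ε => norm_nonneg (Uε ε - U)) ?_ hK1
    filter_upwards [hmem] with ε hε using (est ε hε).1
  · rw [tendsto_iff_norm_sub_tendsto_zero]
    refine squeeze_zero' (Eventually.of_forall fun ε => norm_nonneg (uε ε - u)) ?_ hK2
    filter_upwards [hmem] with ε hε using (est ε hε).2
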